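/- Let $t_1,t_2,\dots$ be commuting variables; all series below are formal power series in them with integer coefficients, and $\mathbb{N}=\{1,2,\dots\}$. A partition $\lambda$ is identified with its Young diagram, with box $(i,j)$ in row $i$ and column $j$; $\lambda\subset(s^r)$ means that $\lambda$ (possibly empty) has at most $r$ rows and at most $s$ columns. For a filling $\gamma=(\gamma_{ij})$ of $\lambda$ by elements of $\mathbb{N}$, the Schur type quasi-symmetric function is \[ S_\lambda(\gamma)=\sum_{(m_{ij})\in\mathrm{SSYT}(\lambda)}\ \prod_{(i,j)\in\lambda}t_{m_{ij}}^{\gamma_{ij}},\qquad S_\emptyset=1, \] where $\mathrm{SSYT}(\lambda)$ is the set of fillings of $\lambda$ by positive integers that increase weakly along the rows (left to right) and strictly down the columns. For $g_1,\dots,g_n\in\mathbb{N}$, the essential quasi-symmetric function is \[ E_{(g_1,\dots,g_n)}=\sum_{m_1\le m_2\le\cdots\le m_n}t_{m_1}^{g_1}t_{m_2}^{g_2}\cdots t_{m_n}^{g_n}, \] and $E_{()}=1$ for $n=0$. Theorem (dual Cauchy formula for Schur type quasi-symmetric functions). Let $r,s$ be non-negative integers. Let $\gamma=(\gamma_{ij})$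 be a filling of $(s^r)$ ($1\le i\le r$, $1\le j\le s$) and $\delta=(\delta_{ij})$ a filling of $(r^s)$ ($1\le i\le s$, $1\le j\le r$) by elements of $\mathbb{N}$, both constant on diagonals, that is, $\gamma_{ij}=c_{j-i}$ and $\delta_{ij}=d_{j-i}$ for integers $c_k,d_k\in\mathbb{N}$. For $\lambda\subset(s^r)$ with conjugate $\lambda'$ put $\lambda^*=(r-\lambda'_s,\dots,r-\lambda'_1)\subset(r^s)$ (with $\lambda'_j=0$ if $j$ exceeds the number of columns of $\lambda$), and let $\gamma|_\lambda$ and $\delta|_{\lambda^*}$ be the restrictions of the fillings to these shapes. Then \[ \sum_{\lambda\subset(s^r)}(-1)^{|\lambda|}\,S_\lambda(\gamma|_\lambda)\,S_{\lambda^*}(\delta|_{\lambda^*})=\det\begin{bmatrix}A\\ B\end{bmatrix}, \] where $A=[A_{ij}]$ is the $r\times(r+s)$ matrix and $B=[B_{ij}]$ the $s\times(r+s)$ matrix with entries \[ A_{ij}=\begin{cases}E_{(c_{i-r},c_{i-r+1},\dots,c_{j-1-r})}& i<j,\\ 1& i=j,\\ 0& i>j,\end{cases} \qquad B_{ij}=\begin{cases}E_{(d_{i-s},d_{i-s+1},\dots,d_{j-1-s})}&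 i<j,\\ 1& i=j,\\ 0& i>j,\end{cases} \] for $1\le j\le r+s$, with $1\le i\le r$ for $A$ and $1\le i\le s$ for $B$. -/

import Mathlib

noncomputable section

namespace SchurQuasi

/-- Formal power series with integer coefficients in the countably many ordered variables
`t_0, t_1, t_2, …`. The variable of index `k : ℕ` here is the one usually called `t_{k+1}`,
so that the entries of Mathlib's semistandard tableaux, which start at `0`, index the variables. -/
abbrev Series : Type := MvPowerSeries ℕ ℤ

/-- The formal sum `∑ i, t ^ (w i)` of a family of monomials: the coefficient of `t ^ m` is the
number of members of the family that are equal to `t ^ m`. It is used only for families in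
which every monomial occurs finitely often, see `finite_tableauWeight` and
`finite_monotoneWeight`. -/
def monomialSum {ι : Type} (w : ι → (ℕ →₀ ℕ)) : Series :=
  fun m => (Nat.card {i : ι // w i = m} : ℤ)

/-- Fillings of the boxes of the Young diagram `μ` by elements of `X`. The box in row `i` and
column `j`, both counted from `0`, is `(i, j)`. -/
abbrev Tableau (μ : YoungDiagram) (X : Type) : Type := μ.cells → X

/-- The fillings of `μ` that are constant on the diagonals `j - i = k`. -/
def diagTableaux (μ : YoungDiagram) (X : Type) : Set (Tableau μ X) :=
  {γ | ∀ x y : μ.cells,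
    (x.1.2 : ℤ) - (x.1.1 : ℤ) = (y.1.2 : ℤ) - (y.1.1 : ℤ) → γ x = γ y}

/-- The restriction of a filling of `ν` to a smaller shape `μ`. -/
def Tableau.restrict {μ ν : YoungDiagram} {X : Type} (γ : Tableau ν X) (h : μ ≤ ν) :
    Tableau μ X :=
  fun x => γ ⟨x.1, h x.2⟩

/-- The exponent of the monomial `∏ t_{m_{ij}} ^ γ_{ij}` of a semistandard tableau `(m_{ij})`. -/
def tableauWeight {μ : YoungDiagram} (γ : Tableau μ ℕ+) (T : SemistandardYoungTableau μ) :
    ℕ →₀ ℕ :=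
  ∑ x : μ.cells, Finsupp.single (T x.1.1 x.1.2) (γ x : ℕ)

/-- The Schur type quasi-symmetric function
`S_μ(γ) = ∑_{(m_{ij}) ∈ SSYT(μ)} ∏_{(i,j)} t_{m_{ij}} ^ γ_{ij}`. -/
def schurQ (μ : YoungDiagram) (γ : Tableau μ ℕ+) : Series :=
  monomialSum (tableauWeight γ)

/-- The exponent of the monomial `∏ k, t_{m_k} ^ γ_k`. -/
def monotoneWeight {n : ℕ} (γ : Fin n → ℕ+) (m : {m : Fin n → ℕ // Monotone m}) : ℕ →₀ ℕ :=
  ∑ k : Fin n, Finsupp.single (m.1 k) (γ k : ℕ)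

/-- The essential quasi-symmetric function
`E_γ = ∑_{m_1 ≤ … ≤ m_n} t_{m_1} ^ γ_1 ⋯ t_{m_n} ^ γ_n`. -/
def essential {n : ℕ} (γ : Fin n → ℕ+) : Series :=
  monomialSum (monotoneWeight γ)

theorem mem_support_sum {ι : Type} [Fintype ι] (f : ι → ℕ) (γ : ι → ℕ+) (x : ι) :
    f x ∈ (∑ y, Finsupp.single (f y) (γ y : ℕ)).support := by
  rw [Finsupp.mem_support_iff, Finsupp.finsetSum_apply]
  have h : (Finsupp.single (f x) (γ x : ℕ)) (f x) ≤
      ∑ y, (Finsupp.single (f y) (γ y : ℕ)) (f x) :=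
    Finset.single_le_sum (f := fun y => (Finsupp.single (f y) (γ y : ℕ)) (f x))
      (fun _ _ => Nat.zero_le _) (Finset.mem_univ x)
  rw [Finsupp.single_eq_same] at h
  have := (γ x).pos
  omega

/-- Every monomial occurs finitely often in the sum that defines `schurQ`. -/
theorem finite_tableauWeight {μ : YoungDiagram} (γ : Tableau μ ℕ+) (m : ℕ →₀ ℕ) :
    Finite {T : SemistandardYoungTableau μ // tableauWeight γ T = m} := by
  have key : ∀ (T : {T : SemistandardYoungTableau μ // tableauWeight γ T = m}) (x : μ.cells),
      T.1 x.1.1 x.1.2 ∈ m.support := by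
    rintro ⟨T, rfl⟩ x
    exact mem_support_sum (fun y : μ.cells => T y.1.1 y.1.2) γ x
  refine Finite.of_injective
    (fun T => (fun x : μ.cells => (⟨T.1 x.1.1 x.1.2, key T x⟩ : m.support))) ?_
  intro T T' h
  apply Subtype.ext
  ext i j
  by_cases hx : (i, j) ∈ μ
  · exact congrArg Subtype.val (congrFun h ⟨(i, j), hx⟩)
  · rw [T.1.zeros hx, T'.1.zeros hx]

/-- Every monomial occurs finitely often in the sum that defines `essential`. -/
theorem finite_monotoneWeight {n : ℕ} (γ : Fin n → ℕ+) (m : ℕ →₀ ℕ) :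
    Finite {f : {f : Fin n → ℕ // Monotone f} // monotoneWeight γ f = m} := by
  have key : ∀ (f : {f : {f : Fin n → ℕ // Monotone f} // monotoneWeight γ f = m}) (x : Fin n),
      f.1.1 x ∈ m.support := by
    rintro ⟨f, rfl⟩ x
    exact mem_support_sum f.1 γ x
  refine Finite.of_injective
    (fun f => (fun x : Fin n => (⟨f.1.1 x, key f x⟩ : m.support))) ?_
  intro f f' h
  apply Subtype.ext
  apply Subtype.ext
  funext x
  exact congrArg Subtype.val (congrFun h x)

/-- The rectangle `(s^r)` with `r` rows of length `s`. -/
def rect (r s : ℕ) : YoungDiagram where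
  cells := Finset.range r ×ˢ Finset.range s
  isLowerSet := by
    rintro ⟨a, b⟩ ⟨c, d⟩ h hab
    have h1 : c ≤ a := h.1
    have h2 : d ≤ b := h.2
    simp only [Finset.coe_product, Finset.coe_range, Set.mem_prod, Set.mem_Iio] at hab ⊢
    omega

theorem mem_rect {r s i j : ℕ} : (i, j) ∈ rect r s ↔ i < r ∧ j < s := by
  rw [← YoungDiagram.mem_cells]
  simp [rect]

/-- There are finitely many Young diagrams inside a given one. -/
instance instFintypeSubdiagram (ν : YoungDiagram) : Fintype {μ : YoungDiagram // μ ≤ ν} :=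
  Fintype.ofInjective
    (fun μ => (⟨μ.1.cells, Finset.mem_powerset.2 μ.2⟩ : ν.cells.powerset))
    (fun _ _ h => Subtype.ext (YoungDiagram.ext (congrArg Subtype.val h)))

/-- For `μ` inside `(s^r)`, the partition `μ* = (r - μ'_s, …, r - μ'_1)`, where `μ'_j` is the
length of column `j` of `μ`. -/
def dualShape (r s : ℕ) (μ : YoungDiagram) : YoungDiagram :=
  YoungDiagram.ofRowLens (List.ofFn fun i : Fin s => r - μ.colLen (s - 1 - i)) (by
    rw [List.sortedGE_ofFn_iff]
    intro i j hij
    have h : (i : ℕ) ≤ j := hij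
    exact Nat.sub_le_sub_left (μ.colLen_anti _ _ (by omega)) r)

theorem mem_dualShape {r s : ℕ} {μ : YoungDiagram} {i j : ℕ} :
    (i, j) ∈ dualShape r s μ ↔ i < s ∧ j < r - μ.colLen (s - 1 - i) := by
  simp [dualShape, YoungDiagram.mem_ofRowLens]

theorem dualShape_le (r s : ℕ) (μ : YoungDiagram) : dualShape r s μ ≤ rect s r := by
  rintro ⟨i, j⟩ h
  obtain ⟨h1, h2⟩ := mem_dualShape.1 h
  exact mem_rect.2 ⟨h1, by omega⟩

/-- The block with `r` rows and `n` columns whose entry in row `i` and column `j` (both counted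
from `1`) is `E_{(c_{i-r}, c_{i+1-r}, …, c_{j-1-r})}`, of length `j - i`, if `i ≤ j` (so that it
is the empty `E`, which is `1`, if `i = j`), and `0` if `j < i`. In the code `i`, `j` and the
position `k` in the composition are counted from `0`. -/
def essentialBlock (r n : ℕ) (c : ℤ → ℕ+) : Matrix (Fin r) (Fin n) Series :=
  Matrix.of fun i j =>
    if (j : ℕ) < i then 0
    else essential fun k : Fin ((j : ℕ) - i) => c ((i : ℤ) + 1 - r + (k : ℕ))

/-- With no exponents, the essential quasi-symmetric function is `1`. -/
theorem essential_zero (γ : Fin 0 → ℕ+) : essential γ = 1 := by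
  classical
  ext m
  rw [MvPowerSeries.coeff_one]
  change (Nat.card {f : {f : Fin 0 → ℕ // Monotone f} // monotoneWeight γ f = m} : ℤ) = _
  have hw : ∀ f, monotoneWeight γ f = 0 := fun f => by simp [monotoneWeight]
  split_ifs with h
  · have : Unique {f : {f : Fin 0 → ℕ // Monotone f} // monotoneWeight γ f = m} :=
      { default := ⟨⟨Fin.elim0, fun a => a.elim0⟩, by rw [hw, h]⟩
        uniq := fun _ => Subtype.ext (Subtype.ext (Subsingleton.elim _ _)) }
    simp
  · have : IsEmpty {f : {f : Fin 0 → ℕ // Monotone f} // monotoneWeight γ f = m} :=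
      ⟨fun f => h (by rw [← f.2, hw])⟩
    simp

end SchurQuasi

end

noncomputable section

namespace SchurQuasi

/-! Expand the determinant by Laplace along its first `r` rows. A set of `r` among the `r + s`
columns is the set of beta numbers (reversed row lengths plus the staircase `0, 1, …, r - 1`) of
exactly one `μ` inside `(s^r)`. The complementary columns are the beta numbers of `μ*`, and the
inversions of the resulting shuffle correspond to the boxes of `μ`; hence the sign `(-1)^|μ|`
(`det_append`). Each minor is then a Schur type function by a Jacobi–Trudi formula
(`schurQ_eq_det`), applied to `μ` with `c` and to `μ*` with `d`.

Since every monomial involves finitely many variables, Jacobi–Trudi may be checked with only `t_k`,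
`k < N`, kept, and there it is an induction on `N` (`tableauSum_eq_minor`). On tableaux, the boxes
with the largest entry form a horizontal strip, and the beta numbers of the remaining shape
interlace with those of the full one (`tableauSum_succ`). On determinants, splitting each entry by
its final run of steps at the largest height, and subtracting a multiple of the preceding column,
leaves a sum over the same interlacing sequences (`minor_succ`). The weights agree because the
fillings are constant on diagonals: box `(i, j)` corresponds to a step at position `j - i + r - 1`,
whatever its row. -/

/-! ### Beta numbers of a diagram -/

theorem add_le_of_strictMono {r : ℕ} {k : Fin r → ℕ} (hk : StrictMono k) {i j : Fin r}
    (hij : i ≤ j) : k i + (j - i : ℕ) ≤ k j := by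
  obtain ⟨j, hj⟩ := j
  induction j with
  | zero =>
    have : i = ⟨0, hj⟩ := le_antisymm hij (Nat.zero_le _)
    subst this; simp
  | succ n ih =>
    rcases eq_or_lt_of_le hij with h | h
    · subst h; simp
    · have h1 : (i : ℕ) < n + 1 := h
      have h2 := ih (by omega) (Fin.le_def.2 (by simpa using Nat.lt_succ_iff.1 h1))
      have h3 : k ⟨n, by omega⟩ < k ⟨n + 1, hj⟩ := hk (Fin.lt_def.2 (Nat.lt_succ_self n))
      simp only at h2 ⊢
      omega

/-- The strictly increasing sequence of beta numbers of a diagram with at most `r` rows. -/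
def beta (r : ℕ) (μ : YoungDiagram) (i : Fin r) : ℕ := μ.rowLen (r - 1 - i) + i

theorem beta_strictMono (r : ℕ) (μ : YoungDiagram) : StrictMono (beta r μ) := by
  intro i j hij
  have h : (i : ℕ) < j := hij
  have := μ.rowLen_anti (r - 1 - j) (r - 1 - i) (by omega)
  simp only [beta]
  omega

theorem mem_iff_lt_beta {r : ℕ} {μ : YoungDiagram} {i j : ℕ} (hi : i < r) :
    (i, j) ∈ μ ↔ j + (r - 1 - i) < beta r μ ⟨r - 1 - i, by omega⟩ := by
  have : r - 1 - (r - 1 - i) = i := by omega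
  simp [beta, YoungDiagram.mem_iff_lt_rowLen, this]

theorem le_of_beta_le {r : ℕ} {μ ν : YoungDiagram} (hν : ∀ x ∈ ν, x.1 < r)
    (h : ∀ i, beta r ν i ≤ beta r μ i) : ν ≤ μ := by
  rintro ⟨i, j⟩ hx
  have hi : i < r := hν _ hx
  have hx' : (i, j) ∈ ν := hx
  rw [mem_iff_lt_beta hi] at hx'
  exact (mem_iff_lt_beta hi).2 (lt_of_lt_of_le hx' (h _))

theorem beta_injective {r : ℕ} {μ ν : YoungDiagram} (hμ : ∀ x ∈ μ, x.1 < r)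
    (hν : ∀ x ∈ ν, x.1 < r) (h : beta r μ = beta r ν) : μ = ν :=
  le_antisymm (le_of_beta_le hμ fun i => (congrFun h i).le)
    (le_of_beta_le hν fun i => (congrFun h i).ge)

theorem beta_le_of_le {r : ℕ} {μ ν : YoungDiagram} (h : ν ≤ μ) (i : Fin r) :
    beta r ν i ≤ beta r μ i := by
  simp only [beta, add_le_add_iff_right]
  by_contra! hlt
  have := h (YoungDiagram.mem_iff_lt_rowLen.2 hlt)
  exact lt_irrefl _ (YoungDiagram.mem_iff_lt_rowLen.1 this)

/-- The differences `k i - i` are nonnegative and weakly increasing, so read backwards they are row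
lengths. -/
theorem exists_beta_eq {r : ℕ} {k : Fin r → ℕ} (hk : StrictMono k) :
    ∃ μ : YoungDiagram, (∀ x ∈ μ, x.1 < r) ∧ beta r μ = k := by
  have hs : (List.ofFn fun i : Fin r => k i.rev - i.rev).SortedGE := by
    rw [List.sortedGE_ofFn_iff]
    intro i j hij
    have h1 := add_le_of_strictMono hk (Fin.rev_le_rev.2 hij)
    have h2 : (j.rev : ℕ) ≤ i.rev := Fin.rev_le_rev.2 hij
    simp only
    omega
  have hmem : ∀ i j, (i, j) ∈ YoungDiagram.ofRowLens _ hs ↔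
      ∃ h : i < r, j < k (Fin.rev ⟨i, h⟩) - (Fin.rev ⟨i, h⟩ : Fin r) := by
    intro i j
    rw [YoungDiagram.mem_ofRowLens]
    simp
  refine ⟨YoungDiagram.ofRowLens _ hs, fun x hx => ((hmem x.1 x.2).1 hx).1, ?_⟩
  funext i
  have hrow : (YoungDiagram.ofRowLens _ hs).rowLen (r - 1 - i) = k i - i := by
    have hlt : r - 1 - i < r := by omega
    have hrev : Fin.rev ⟨r - 1 - i, hlt⟩ = i := by ext; simp; omega
    apply eq_of_forall_lt_iff
    intro j
    rw [← YoungDiagram.mem_iff_lt_rowLen, hmem]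
    simp [hrev, hlt]
  have h0 : (i : ℕ) ≤ k i := by
    have := add_le_of_strictMono hk (i := ⟨0, by omega⟩) (j := i) (Nat.zero_le _)
    simp only at this
    omega
  rw [beta, hrow]
  omega

/-! ### Path sums and their minors -/

variable {R : Type*} [CommRing R]

/-- The sum over weakly increasing sequences of heights below the first argument of the products
of the weights `v` of the horizontal steps `b - 1, …, a`, defined recursively. -/
def pathSum (v : ℕ → ℕ → R) : ℕ → ℕ → ℕ → R
  | 0, a, b => if a = b then 1 else 0
  | N + 1, a, 0 => pathSum v N a 0
  | N + 1, a, b + 1 => pathSum v N a (b + 1) + v N b * pathSum v (N + 1) a b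

theorem pathSum_of_lt (v : ℕ → ℕ → R) {a b : ℕ} (N : ℕ) (h : b < a) : pathSum v N a b = 0 := by
  induction N generalizing b with
  | zero => simp [pathSum, h.ne']
  | succ N ih =>
    induction b with
    | zero => simp [pathSum, ih h]
    | succ b ihb => simp [pathSum, ih h, ihb (by omega)]

theorem pathSum_self (v : ℕ → ℕ → R) (a N : ℕ) : pathSum v N a a = 1 := by
  induction N with
  | zero => simp [pathSum]
  | succ N ih =>
    cases a with
    | zero => simpa [pathSum] using ih
    | succ a => simp [pathSum, ih, pathSum_of_lt v (N + 1) (Nat.lt_succ_self a)]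

/-- Steps at the top height `N` come last. Either their run starts at some `b > q`, or all steps
from `q` to `k` have height `N` and the part before `q` is arbitrary. -/
theorem pathSum_succ_eq_sum_Ico (v : ℕ → ℕ → R) (N a : ℕ) {q k : ℕ} (h : q ≤ k) :
    pathSum v (N + 1) a k =
      ∑ b ∈ Finset.Ico (q + 1) (k + 1), (∏ p ∈ Finset.Ico b k, v N p) * pathSum v N a b
        + (∏ p ∈ Finset.Ico q k, v N p) * pathSum v (N + 1) a q := by
  induction k, h using Nat.le_induction with
  | base => simp
  | succ k h ih =>
    rw [pathSum, ih, Finset.sum_Ico_succ_top (b := k + 1) (by omega), Finset.prod_Ico_succ_top h,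
      mul_add, Finset.mul_sum]
    have : ∑ b ∈ Finset.Ico (q + 1) (k + 1), v N k * ((∏ p ∈ Finset.Ico b k, v N p)
          * pathSum v N a b) =
        ∑ b ∈ Finset.Ico (q + 1) (k + 1), (∏ p ∈ Finset.Ico b (k + 1), v N p)
          * pathSum v N a b := by
      refine Finset.sum_congr rfl fun b hb => ?_
      rw [Finset.prod_Ico_succ_top (by have := Finset.mem_Ico.1 hb; omega)]
      ring
    rw [this, Finset.Ico_self, Finset.prod_empty]
    ring

theorem pathSum_succ_eq_sum_range (v : ℕ → ℕ → R) (N a k : ℕ) :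
    pathSum v (N + 1) a k =
      ∑ b ∈ Finset.Ico 0 (k + 1), (∏ p ∈ Finset.Ico b k, v N p) * pathSum v N a b := by
  rw [pathSum_succ_eq_sum_Ico v N a (Nat.zero_le k), Finset.sum_eq_sum_Ico_succ_bot (Nat.succ_pos k), pathSum]
  exact add_comm _ _

/-- The minor of the matrix of path sums with columns `k`. -/
def minor (v : ℕ → ℕ → R) (N : ℕ) {r : ℕ} (k : Fin r → ℕ) : R :=
  Matrix.det (Matrix.of fun i j : Fin r => pathSum v N i (k j))

/-- The smallest value allowed at position `i` in a sequence that interlaces with `k`. -/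
def lowerEnd {r : ℕ} (k : Fin r → ℕ) (i : Fin r) : ℕ :=
  if h : (i : ℕ) = 0 then 0 else k ⟨i - 1, by omega⟩ + 1

/-- The sequences that interlace with `k`. -/
def interlacing {r : ℕ} (k : Fin r → ℕ) : Finset (Fin r → ℕ) :=
  Fintype.piFinset fun i => Finset.Ico (lowerEnd k i) (k i + 1)

/-- Taking `q` to be the preceding column index in `pathSum_succ_eq_sum_Ico` shows that each column
is a truncated sum plus a multiple of the preceding column. That multiple does not change the
determinant, and multilinearity expands the rest. -/
theorem minor_succ (v : ℕ → ℕ → R) (N : ℕ) {r : ℕ} {k : Fin r → ℕ} (hk : StrictMono k) :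
    minor v (N + 1) k =
      ∑ b ∈ interlacing k, (∏ i, ∏ p ∈ Finset.Ico (b i) (k i), v N p) * minor v N b := by
  have h1 : minor v (N + 1) k = Matrix.det (Matrix.of fun i j : Fin r =>
      ∑ b ∈ Finset.Ico (lowerEnd k j) (k j + 1),
        (∏ p ∈ Finset.Ico b (k j), v N p) * pathSum v N i b) := by
    cases r with
    | zero => simp [minor]
    | succ n =>
      refine Matrix.det_eq_of_forall_col_eq_smul_add_pred
        (fun j => ∏ p ∈ Finset.Ico (k j.castSucc) (k j.succ), v N p) ?_ ?_
      · intro i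
        simpa [lowerEnd] using pathSum_succ_eq_sum_range v N i (k 0)
      · intro i j
        have := pathSum_succ_eq_sum_Ico v N i (hk j.castSucc_lt_succ).le
        simpa [lowerEnd, Fin.castSucc, Fin.castAdd, Fin.castLE] using this
  rw [h1, ← Matrix.det_transpose]
  have h2 := (Matrix.detRowAlternating (n := Fin r) (R := R)).toMultilinearMap.map_sum_finset
    (fun (j : Fin r) (b : ℕ) (i : Fin r) => (∏ p ∈ Finset.Ico b (k j), v N p) * pathSum v N i b)
    (fun j => Finset.Ico (lowerEnd k j) (k j + 1))
  have h3 : (Matrix.of fun i j : Fin r =>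
      ∑ b ∈ Finset.Ico (lowerEnd k j) (k j + 1),
        (∏ p ∈ Finset.Ico b (k j), v N p) * pathSum v N i b).transpose =
      fun j => ∑ b ∈ Finset.Ico (lowerEnd k j) (k j + 1),
        fun i : Fin r => (∏ p ∈ Finset.Ico b (k j), v N p) * pathSum v N i b := by
    ext j i
    simp [Finset.sum_apply]
  rw [h3]
  refine h2.trans (Finset.sum_congr rfl fun b _ => ?_)
  rw [minor, ← Matrix.det_transpose]
  exact (Matrix.detRowAlternating (n := Fin r) (R := R)).toMultilinearMap.map_smul_univ
    (fun j => ∏ p ∈ Finset.Ico (b j) (k j), v N p) (fun j i => pathSum v N i (b j))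

/-! ### Bounded tableaux and removal of the largest entry -/

/-- The semistandard tableaux with entries less than `N`. -/
abbrev BoundedTableau (N : ℕ) (μ : YoungDiagram) : Type :=
  {T : SemistandardYoungTableau μ // ∀ i j, (i, j) ∈ μ → T i j < N}

instance (N : ℕ) (μ : YoungDiagram) : Finite (BoundedTableau N μ) := by
  refine Finite.of_injective
    (fun T (x : μ.cells) => (⟨T.1 x.1.1 x.1.2, T.2 _ _ x.2⟩ : Fin N)) ?_
  intro T T' h
  apply Subtype.ext
  ext i j
  by_cases hx : (i, j) ∈ μ
  · exact congrArg Fin.val (congrFun h ⟨(i, j), hx⟩)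
  · rw [T.1.zeros hx, T'.1.zeros hx]

instance (N : ℕ) (μ : YoungDiagram) : Fintype (BoundedTableau N μ) := Fintype.ofFinite _

/-- `μ / ν` is a horizontal strip. -/
def IsStrip (ν μ : YoungDiagram) : Prop := ν ≤ μ ∧ ∀ i j, (i + 1, j) ∈ μ → (i, j) ∈ ν

instance (μ : YoungDiagram) : Finite {ν // IsStrip ν μ} :=
  Finite.of_injective (fun ν => (⟨ν.1, ν.2.1⟩ : {ν // ν ≤ μ})) fun _ _ h =>
    Subtype.ext (congrArg (fun x : {ν // ν ≤ μ} => x.1) h)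

instance (μ : YoungDiagram) : Fintype {ν // IsStrip ν μ} := Fintype.ofFinite _

/-- The generating function of the bounded semistandard tableaux of a shape, where an entry `m` in
the box `x` has the weight `u m x`. -/
def tableauSum (u : ℕ → ℕ × ℕ → R) (N : ℕ) (μ : YoungDiagram) : R :=
  ∑ T : BoundedTableau N μ, ∏ x ∈ μ.cells, u (T.1 x.1 x.2) x

open Classical in
/-- Fill the boxes of a horizontal strip with a new largest entry. -/
def BoundedTableau.extend {N : ℕ} {ν μ : YoungDiagram} (h : IsStrip ν μ)
    (T : BoundedTableau N ν) : BoundedTableau (N + 1) μ where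
  val :=
    { entry := fun i j => if (i, j) ∈ ν then T.1 i j else if (i, j) ∈ μ then N else 0
      row_weak' := by
        intro i j₁ j₂ hj hμ
        have hμ' : (i, j₁) ∈ μ := μ.up_left_mem le_rfl hj.le hμ
        by_cases h₂ : (i, j₂) ∈ ν
        · have h₁ : (i, j₁) ∈ ν := ν.up_left_mem le_rfl hj.le h₂
          simpa [h₁, h₂] using T.1.row_weak hj h₂
        · by_cases h₁ : (i, j₁) ∈ ν
          · simpa [h₁, h₂, hμ] using (T.2 _ _ h₁).le
          · simp [h₁, h₂, hμ, hμ']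
      col_strict' := by
        intro i₁ i₂ j hi hμ
        -- The box just below `(i₁, j)` is still in `μ`, so the strip condition applies.
        have h₁ : (i₁, j) ∈ ν := h.2 _ _ (μ.up_left_mem (Nat.succ_le_of_lt hi) le_rfl hμ)
        by_cases h₂ : (i₂, j) ∈ ν
        · simpa [h₁, h₂] using T.1.col_strict hi h₂
        · simpa [h₁, h₂, hμ] using T.2 _ _ h₁
      zeros' := by
        intro i j hμ
        have : (i, j) ∉ ν := fun hν => hμ (h.1 hν)
        simp [hμ, this] }
  property := by
    intro i j hμ
    change (if (i, j) ∈ ν then T.1 i j else if (i, j) ∈ μ then N else 0) < N + 1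
    split_ifs with hν
    · exact (T.2 _ _ hν).trans (Nat.lt_succ_self N)
    · exact Nat.lt_succ_self N

open Classical in
theorem BoundedTableau.extend_apply {N : ℕ} {ν μ : YoungDiagram} (h : IsStrip ν μ)
    (T : BoundedTableau N ν) (i j : ℕ) : (T.extend h).1 i j =
      if (i, j) ∈ ν then T.1 i j else if (i, j) ∈ μ then N else 0 := rfl

theorem BoundedTableau.mem_iff_extend_lt {N : ℕ} {ν μ : YoungDiagram} (h : IsStrip ν μ)
    (T : BoundedTableau N ν) (i j : ℕ) : (i, j) ∈ ν ↔ (i, j) ∈ μ ∧ (T.extend h).1 i j < N := by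
  rw [BoundedTableau.extend_apply]
  constructor
  · intro hν
    simpa [hν] using ⟨h.1 hν, T.2 _ _ hν⟩
  · rintro ⟨hμ, hlt⟩
    by_contra hν
    simp [hν, hμ] at hlt

/-- The inverse keeps the boxes with entry less than `N`. Strictness down the columns allows at most
one entry `N` per column, at its bottom, so the removed boxes form a horizontal strip. -/
theorem BoundedTableau.extend_bijective (N : ℕ) (μ : YoungDiagram) :
    Function.Bijective fun p : (Σ ν : {ν // IsStrip ν μ}, BoundedTableau N ν.1) =>
      p.2.extend p.1.2 := by
  constructor
  · rintro ⟨⟨ν, h⟩, T⟩ ⟨⟨ν', h'⟩, T'⟩ heq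
    simp only at heq
    have hν : ν = ν' := by
      ext ⟨i, j⟩
      rw [YoungDiagram.mem_cells, YoungDiagram.mem_cells, T.mem_iff_extend_lt h, heq,
        ← T'.mem_iff_extend_lt h']
    subst hν
    congr 1
    apply Subtype.ext
    ext i j
    by_cases hx : (i, j) ∈ ν
    · have h1 := T.extend_apply h i j
      rw [heq, T'.extend_apply] at h1
      simpa [hx] using h1.symm
    · rw [T.1.zeros hx, T'.1.zeros hx]
  · intro T
    let ν : YoungDiagram :=
      { cells := μ.cells.filter fun x => T.1 x.1 x.2 < N
        isLowerSet := by
          rintro ⟨a, b⟩ ⟨c, d⟩ hle hab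
          have hab' : (a, b) ∈ μ ∧ T.1 a b < N := by simpa using hab
          have h1 : (c, b) ∈ μ := μ.up_left_mem hle.1 le_rfl hab'.1
          have h2 : (c, d) ∈ μ := μ.up_left_mem le_rfl hle.2 h1
          have h3 : T.1 c b ≤ T.1 a b := T.1.col_weak hle.1 hab'.1
          have h4 : T.1 c d ≤ T.1 c b := T.1.row_weak_of_le hle.2 h1
          have h5 : (c, d) ∈ μ ∧ T.1 c d < N := ⟨h2, by omega⟩
          simpa using h5 }
    have hmem : ∀ i j, (i, j) ∈ ν ↔ (i, j) ∈ μ ∧ T.1 i j < N := by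
      intro i j
      rw [← YoungDiagram.mem_cells]
      simp [ν]
    have hstrip : IsStrip ν μ := by
      constructor
      · rintro ⟨i, j⟩ hx
        exact ((hmem i j).1 hx).1
      · intro i j hμ
        have h1 := T.1.col_strict (Nat.lt_add_one i) hμ
        have h2 := T.2 _ _ hμ
        exact (hmem i j).2 ⟨μ.up_left_mem (Nat.le_succ i) le_rfl hμ, by omega⟩
    classical
    let T' : SemistandardYoungTableau ν :=
      { entry := fun i j => if (i, j) ∈ ν then T.1 i j else 0
        row_weak' := by
          intro i j₁ j₂ hj hν
          have h₁ : (i, j₁) ∈ ν := ν.up_left_mem le_rfl hj.le hν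
          simpa [h₁, hν] using T.1.row_weak hj ((hmem _ _).1 hν).1
        col_strict' := by
          intro i₁ i₂ j hi hν
          have h₁ : (i₁, j) ∈ ν := ν.up_left_mem hi.le le_rfl hν
          simpa [h₁, hν] using T.1.col_strict hi ((hmem _ _).1 hν).1
        zeros' := by
          intro i j hν
          simp [hν] }
    have hT' : ∀ i j, T' i j = if (i, j) ∈ ν then T.1 i j else 0 := fun _ _ => rfl
    refine ⟨⟨⟨ν, hstrip⟩, ⟨T', ?_⟩⟩, ?_⟩
    · intro i j hν
      rw [hT', if_pos hν]
      exact ((hmem _ _).1 hν).2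
    · apply Subtype.ext
      ext i j
      simp only [BoundedTableau.extend_apply, hT']
      split_ifs with h1 h2
      · rfl
      · have h3 := T.2 _ _ h2
        have h4 : ¬ T.1 i j < N := fun h => h1 ((hmem _ _).2 ⟨h2, h⟩)
        omega
      · exact (T.1.zeros h2).symm

theorem tableauSum_succ (u : ℕ → ℕ × ℕ → R) (N : ℕ) (μ : YoungDiagram) :
    tableauSum u (N + 1) μ =
      ∑ ν : {ν // IsStrip ν μ}, (∏ x ∈ μ.cells \ ν.1.cells, u N x) * tableauSum u N ν.1 := by
  rw [tableauSum, ← Fintype.sum_bijective _ (BoundedTableau.extend_bijective N μ) _ _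
    (fun _ => rfl), Fintype.sum_sigma]
  refine Finset.sum_congr rfl fun ν _ => ?_
  rw [tableauSum, Finset.mul_sum]
  refine Finset.sum_congr rfl fun T _ => ?_
  have hsub : ν.1.cells ⊆ μ.cells := ν.2.1
  rw [← Finset.prod_sdiff hsub]
  congr 1
  · refine Finset.prod_congr rfl fun x hx => ?_
    rw [Finset.mem_sdiff, YoungDiagram.mem_cells, YoungDiagram.mem_cells] at hx
    rw [BoundedTableau.extend_apply, if_neg hx.2, if_pos hx.1]
  · refine Finset.prod_congr rfl fun x hx => ?_
    rw [YoungDiagram.mem_cells] at hx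
    rw [BoundedTableau.extend_apply, if_pos hx]

/-! ### Horizontal strips as interlacing beta numbers, and finite Jacobi–Trudi -/

/-- Within one row, the boxes of `μ / ν` occupy the consecutive positions from the beta number of
`ν` up to that of `μ`. -/
theorem prod_sdiff_cells {r : ℕ} {μ ν : YoungDiagram} (hμ : ∀ x ∈ μ, x.1 < r) (g : ℕ → R) :
    ∏ x ∈ μ.cells \ ν.cells, g (x.2 + (r - 1 - x.1)) =
      ∏ i, ∏ p ∈ Finset.Ico (beta r ν i) (beta r μ i), g p := by
  have key : ∀ x : ℕ × ℕ, x ∈ μ.cells \ ν.cells ↔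
      ∃ h : x.1 < r, x.2 + (r - 1 - x.1) ∈ Finset.Ico (beta r ν ⟨r - 1 - x.1, by omega⟩)
        (beta r μ ⟨r - 1 - x.1, by omega⟩) := by
    rintro ⟨i, j⟩
    rw [Finset.mem_sdiff, YoungDiagram.mem_cells, YoungDiagram.mem_cells]
    constructor
    · rintro ⟨h1, h2⟩
      have hi := hμ _ h1
      rw [mem_iff_lt_beta hi] at h1 h2
      exact ⟨hi, Finset.mem_Ico.2 ⟨not_lt.1 h2, h1⟩⟩
    · rintro ⟨hi, h⟩
      rw [mem_iff_lt_beta hi, mem_iff_lt_beta hi]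
      exact ⟨(Finset.mem_Ico.1 h).2, not_lt.2 (Finset.mem_Ico.1 h).1⟩
  rw [Finset.prod_sigma']
  refine Finset.prod_bij' (fun x hx => ⟨⟨r - 1 - x.1, by have := ((key x).1 hx).1; omega⟩,
    x.2 + (r - 1 - x.1)⟩) (fun y _ => (r - 1 - y.1, y.2 - y.1)) ?_ ?_ ?_ ?_ ?_
  · intro x hx
    exact Finset.mem_sigma.2 ⟨Finset.mem_univ _, ((key x).1 hx).2⟩
  · rintro ⟨i, p⟩ hy
    have h1 := (Finset.mem_sigma.1 hy).2
    have hp : (i : ℕ) ≤ p := le_trans (by simp [beta]) (Finset.mem_Ico.1 h1).1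
    have hi : r - 1 - (r - 1 - (i : ℕ)) = i := by omega
    refine (key _).2 ⟨by simp only; omega, ?_⟩
    simp only [hi, Nat.sub_add_cancel hp]
    exact h1
  · rintro ⟨i, j⟩ hx
    have := ((key _).1 hx).1
    simp only at this
    ext <;> simp only <;> omega
  · rintro ⟨i, p⟩ hy
    have h1 := (Finset.mem_sigma.1 hy).2
    have hp : (i : ℕ) ≤ p := le_trans (by simp [beta]) (Finset.mem_Ico.1 h1).1
    have hi : r - 1 - (r - 1 - (i : ℕ)) = i := by omega
    simp only [hi, Nat.sub_add_cancel hp]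
  · intro x _
    rfl

/-- A horizontal strip means `μ_{i+1} ≤ ν_i ≤ μ_i`; the staircase shift makes the lower inequality
strict. -/
theorem beta_mem_interlacing {r : ℕ} {μ ν : YoungDiagram} (h : IsStrip ν μ) :
    beta r ν ∈ interlacing (beta r μ) := by
  rw [interlacing, Fintype.mem_piFinset]
  intro i
  rw [Finset.mem_Ico, Nat.lt_succ_iff]
  refine ⟨?_, beta_le_of_le h.1 i⟩
  rw [lowerEnd]
  split_ifs with h0
  · exact Nat.zero_le _
  · simp only [beta]
    have h1 : r - 1 - ((i : ℕ) - 1) = r - 1 - i + 1 := by omega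
    have h2 : μ.rowLen (r - 1 - i + 1) ≤ ν.rowLen (r - 1 - i) := by
      by_contra! hlt
      have := h.2 _ _ (YoungDiagram.mem_iff_lt_rowLen.2 hlt)
      exact lt_irrefl _ (YoungDiagram.mem_iff_lt_rowLen.1 this)
    rw [h1]
    omega

theorem exists_isStrip {r : ℕ} {μ : YoungDiagram} (hμ : ∀ x ∈ μ, x.1 < r) {b : Fin r → ℕ}
    (hb : b ∈ interlacing (beta r μ)) : ∃ ν, IsStrip ν μ ∧ beta r ν = b := by
  rw [interlacing, Fintype.mem_piFinset] at hb
  have hlow : ∀ i j : Fin r, i < j → beta r μ i < b j := by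
    intro i j hij
    have hij' : (i : ℕ) < j := hij
    have h1 := (Finset.mem_Ico.1 (hb j)).1
    rw [lowerEnd, dif_neg (by omega)] at h1
    refine lt_of_le_of_lt ((beta_strictMono r μ).monotone ?_) h1
    exact Fin.le_def.2 (by simp only; omega)
  have hup : ∀ i, b i ≤ beta r μ i := fun i =>
    Nat.lt_succ_iff.1 (Finset.mem_Ico.1 (hb i)).2
  obtain ⟨ν, hν, rfl⟩ := exists_beta_eq (k := b) fun i j hij => (hup i).trans_lt (hlow i j hij)
  refine ⟨ν, ⟨le_of_beta_le hν hup, ?_⟩, rfl⟩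
  intro i j hx
  have hi : i + 1 < r := hμ _ hx
  rw [mem_iff_lt_beta hi] at hx
  rw [mem_iff_lt_beta (by omega : i < r)]
  have := hlow ⟨r - 1 - (i + 1), by omega⟩ ⟨r - 1 - i, by omega⟩ (Fin.lt_def.2 (by simp only; omega))
  omega

open Classical in
theorem minor_zero (v : ℕ → ℕ → R) {r : ℕ} {μ : YoungDiagram} (hμ : ∀ x ∈ μ, x.1 < r) :
    minor v 0 (beta r μ) = if μ = ⊥ then 1 else 0 := by
  split_ifs with h
  · subst h
    have hb : ∀ i : Fin r, beta r ⊥ i = i := by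
      intro i
      have : (⊥ : YoungDiagram).rowLen (r - 1 - i) = 0 := by
        by_contra h0
        exact YoungDiagram.notMem_bot _
          (YoungDiagram.mem_iff_lt_rowLen.2 (Nat.pos_of_ne_zero h0))
      simp [beta, this]
    have : (Matrix.of fun i j : Fin r => pathSum v 0 i (beta r ⊥ j)) = 1 := by
      ext i j
      simp [hb, pathSum, Matrix.one_apply, Fin.ext_iff]
    rw [minor, this, Matrix.det_one]
  · obtain ⟨⟨i, j⟩, hx⟩ : ∃ x, x ∈ μ := by
      by_contra! hne
      exact h (le_antisymm (fun x hx => absurd hx (hne x)) bot_le)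
    have hr : i < r := hμ _ hx
    -- The last index records the first row, which is nonempty; its beta number is at least `r` and
    -- so differs from every row index of the minor.
    refine Matrix.det_eq_zero_of_column_eq_zero ⟨r - 1, by omega⟩ fun a => ?_
    have h0 : (0, 0) ∈ μ := μ.up_left_mem (Nat.zero_le _) (Nat.zero_le _) hx
    rw [mem_iff_lt_beta (by omega : 0 < r)] at h0
    simp only [Nat.sub_zero] at h0
    have := a.2
    simp only [Matrix.of_apply, pathSum]
    rw [if_neg (by omega)]

open Classical in
theorem tableauSum_zero (u : ℕ → ℕ × ℕ → R) (μ : YoungDiagram) :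
    tableauSum u 0 μ = if μ = ⊥ then 1 else 0 := by
  split_ifs with h
  · subst h
    have : Unique (BoundedTableau 0 ⊥) :=
      { default := ⟨⟨fun _ _ => 0, fun _ h => absurd h (YoungDiagram.notMem_bot _),
          fun _ h => absurd h (YoungDiagram.notMem_bot _), fun _ => rfl⟩,
          fun _ _ h => absurd h (YoungDiagram.notMem_bot _)⟩
        uniq := fun T => Subtype.ext (by
          ext i j
          rw [T.1.zeros (YoungDiagram.notMem_bot _)]
          rfl) }
    rw [tableauSum, Fintype.sum_unique]
    simp
  · obtain ⟨⟨i, j⟩, hx⟩ : ∃ x, x ∈ μ := by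
      by_contra! hne
      exact h (le_antisymm (fun x hx => absurd hx (hne x)) bot_le)
    have : IsEmpty (BoundedTableau 0 μ) := ⟨fun T => Nat.not_lt_zero _ (T.2 _ _ hx)⟩
    rw [tableauSum, Fintype.sum_empty]

/-- The Jacobi–Trudi formula in finitely many variables. -/
theorem tableauSum_eq_minor (v : ℕ → ℕ → R) (N : ℕ) {r : ℕ} {μ : YoungDiagram}
    (hμ : ∀ x ∈ μ, x.1 < r) :
    tableauSum (fun m x => v m (x.2 + (r - 1 - x.1))) N μ = minor v N (beta r μ) := by
  induction N generalizing μ with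
  | zero => rw [tableauSum_zero, minor_zero v hμ]
  | succ N ih =>
    rw [tableauSum_succ, minor_succ v N (beta_strictMono r μ)]
    have hν : ∀ ν : {ν // IsStrip ν μ}, ∀ x ∈ ν.1, x.1 < r := fun ν x hx => hμ x (ν.2.1 hx)
    refine Finset.sum_bij (fun ν _ => beta r ν.1) (fun ν _ => beta_mem_interlacing ν.2) ?_ ?_ ?_
    · intro ν _ ν' _ h
      exact Subtype.ext (beta_injective (hν ν) (hν ν') h)
    · intro b hb
      obtain ⟨ν, h, rfl⟩ := exists_isStrip hμ hb
      exact ⟨⟨ν, h⟩, Finset.mem_univ _, rfl⟩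
    · intro ν _
      rw [ih (hν ν), prod_sdiff_cells hμ]

/-! ### Reduction to finitely many variables -/

/-- The part of a power series in the variables `t_k` with `k < N`. -/
def truncationFun (N : ℕ) (f : Series) : Series :=
  fun m => if ∀ k ∈ m.support, k < N then MvPowerSeries.coeff m f else 0

theorem coeff_truncationFun (N : ℕ) (f : Series) (m : ℕ →₀ ℕ) :
    MvPowerSeries.coeff m (truncationFun N f) =
      if ∀ k ∈ m.support, k < N then MvPowerSeries.coeff m f else 0 := rfl

theorem forall_mem_support_add_lt_iff (N : ℕ) (p q : ℕ →₀ ℕ) :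
    (∀ k ∈ (p + q).support, k < N) ↔ (∀ k ∈ p.support, k < N) ∧ ∀ k ∈ q.support, k < N := by
  simp only [Finsupp.mem_support_iff, Finsupp.add_apply, ne_eq, Nat.add_eq_zero_iff, not_and_or]
  exact ⟨fun h => ⟨fun k hk => h k (Or.inl hk), fun k hk => h k (Or.inr hk)⟩,
    fun h k hk => hk.elim (h.1 k) (h.2 k)⟩

/-- The ring homomorphism that sets the variables `t_k` with `k ≥ N` to zero. -/
def truncation (N : ℕ) : Series →+* Series where
  toFun := truncationFun N
  map_one' := by
    classical
    refine MvPowerSeries.ext fun m => ?_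
    rw [coeff_truncationFun, MvPowerSeries.coeff_one, ite_eq_left_iff]
    intro h
    rw [if_neg]
    rintro rfl
    simp at h
  map_mul' f g := by
    classical
    refine MvPowerSeries.ext fun m => ?_
    rw [coeff_truncationFun, MvPowerSeries.coeff_mul, MvPowerSeries.coeff_mul,
      Finset.ite_sum_zero]
    refine Finset.sum_congr rfl fun p hp => ?_
    rw [← Finset.HasAntidiagonal.mem_antidiagonal.1 hp]
    simp only [coeff_truncationFun, forall_mem_support_add_lt_iff, ite_and, ite_mul, mul_ite,
      zero_mul, mul_zero]
    split_ifs <;> rfl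
  map_zero' := by
    refine MvPowerSeries.ext fun m => ?_
    simp [coeff_truncationFun]
  map_add' f g := by
    refine MvPowerSeries.ext fun m => ?_
    rw [map_add, coeff_truncationFun, coeff_truncationFun, coeff_truncationFun, map_add]
    split_ifs <;> simp

theorem coeff_truncation (N : ℕ) (f : Series) (m : ℕ →₀ ℕ) :
    MvPowerSeries.coeff m (truncation N f) =
      if ∀ k ∈ m.support, k < N then MvPowerSeries.coeff m f else 0 := rfl

theorem ext_truncation {f g : Series} (h : ∀ N, truncation N f = truncation N g) : f = g := by
  refine MvPowerSeries.ext fun m => ?_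
  have hm : ∀ k ∈ m.support, k < m.support.sup id + 1 := fun k hk =>
    Nat.lt_succ_of_le (Finset.le_sup (f := id) hk)
  have := congrArg (MvPowerSeries.coeff m) (h (m.support.sup id + 1))
  rwa [coeff_truncation, coeff_truncation, if_pos hm, if_pos hm] at this

theorem truncation_monomialSum {ι κ : Type} [Fintype κ] (w : ι → (ℕ →₀ ℕ)) (N : ℕ) (e : κ → ι)
    (he : Function.Injective e) (h : ∀ i, (∃ x, e x = i) ↔ ∀ k ∈ (w i).support, k < N) :
    truncation N (monomialSum w) = ∑ x, MvPowerSeries.monomial (w (e x)) (1 : ℤ) := by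
  classical
  refine MvPowerSeries.ext fun m => ?_
  rw [coeff_truncation, map_sum]
  simp only [MvPowerSeries.coeff_monomial]
  split_ifs with hm
  · change (Nat.card {i : ι // w i = m} : ℤ) = _
    have hcard : Nat.card {i : ι // w i = m} = Nat.card {x : κ // w (e x) = m} := by
      refine (Nat.card_eq_of_bijective (fun x : {x : κ // w (e x) = m} =>
        (⟨e x.1, x.2⟩ : {i : ι // w i = m})) ⟨?_, ?_⟩).symm
      · intro x y hxy
        exact Subtype.ext (he (congrArg Subtype.val hxy))
      · rintro ⟨i, rfl⟩
        obtain ⟨x, rfl⟩ := (h i).2 hm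
        exact ⟨⟨x, rfl⟩, rfl⟩
    rw [hcard, Nat.card_eq_fintype_card, Fintype.card_subtype, Finset.sum_boole]
    simp [eq_comm]
  · refine (Finset.sum_eq_zero fun x _ => if_neg ?_).symm
    rintro rfl
    exact hm ((h _).1 ⟨x, rfl⟩)

theorem monomial_sum_single {ι : Type} [Fintype ι] (f g : ι → ℕ) :
    (MvPowerSeries.monomial (∑ x, Finsupp.single (f x) (g x)) (1 : ℤ) : Series) =
      ∏ x, MvPowerSeries.X (f x) ^ g x := by
  classical
  have : ∀ t : Finset ι, (MvPowerSeries.monomial (∑ x ∈ t, Finsupp.single (f x) (g x)) (1 : ℤ) :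
      Series) = ∏ x ∈ t, MvPowerSeries.X (f x) ^ g x := by
    intro t
    induction t using Finset.induction_on with
    | empty => simp
    | insert a t ha ih =>
      rw [Finset.sum_insert ha, Finset.prod_insert ha, ← ih, MvPowerSeries.X_pow_eq,
        MvPowerSeries.monomial_mul_monomial, one_mul]
  exact this _

/-- Positivity of the exponents matters here: every entry of a filling really occurs in its
monomial, so truncating the series amounts to bounding the entries. -/
theorem forall_mem_support_sum_lt_iff {ι : Type} [Fintype ι] (f : ι → ℕ) (γ : ι → ℕ+) (N : ℕ) :
    (∀ k ∈ (∑ y, Finsupp.single (f y) (γ y : ℕ)).support, k < N) ↔ ∀ x, f x < N := by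
  classical
  constructor
  · exact fun h x => h _ (mem_support_sum f γ x)
  · intro h k hk
    obtain ⟨x, _, hx⟩ := Finset.mem_biUnion.1 (Finsupp.support_finsetSum hk)
    have : k = f x := Finset.mem_singleton.1 (Finsupp.support_single_subset hx)
    exact this ▸ h x

theorem truncation_schurQ {μ : YoungDiagram} (γ : Tableau μ ℕ+) (u : ℕ → ℕ × ℕ → Series)
    (hu : ∀ m (x : μ.cells), u m x.1 = MvPowerSeries.X m ^ (γ x : ℕ)) (N : ℕ) :
    truncation N (schurQ μ γ) = tableauSum u N μ := by
  rw [schurQ, truncation_monomialSum (κ := BoundedTableau N μ) _ N Subtype.val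
    Subtype.val_injective, tableauSum]
  · refine Finset.sum_congr rfl fun T _ => ?_
    rw [tableauWeight, monomial_sum_single, ← Finset.prod_coe_sort μ.cells]
    exact Finset.prod_congr rfl fun x _ => (hu _ x).symm
  · intro T
    rw [tableauWeight, forall_mem_support_sum_lt_iff]
    constructor
    · rintro ⟨T, rfl⟩ x
      exact T.2 _ _ x.2
    · intro h
      exact ⟨⟨T, fun i j hx => h ⟨(i, j), hx⟩⟩, rfl⟩

/-! ### Essential functions as path sums -/

/-- The weakly increasing sequences with entries less than `N`. -/
abbrev BoundedSeq (N n : ℕ) : Type := {f : Fin n → ℕ // Monotone f ∧ ∀ i, f i < N}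

instance (N n : ℕ) : Finite (BoundedSeq N n) :=
  Finite.of_injective (fun f (i : Fin n) => (⟨f.1 i, f.2.2 i⟩ : Fin N)) fun _ _ h =>
    Subtype.ext (funext fun i => congrArg Fin.val (congrFun h i))

instance (N n : ℕ) : Fintype (BoundedSeq N n) := Fintype.ofFinite _

/-- A weakly increasing sequence either avoids the largest value or ends with it. -/
def BoundedSeq.glue (N n : ℕ) : BoundedSeq N (n + 1) ⊕ BoundedSeq (N + 1) n →
    BoundedSeq (N + 1) (n + 1)
  | .inl f => ⟨f.1, f.2.1, fun i => (f.2.2 i).trans (Nat.lt_succ_self N)⟩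
  | .inr f => ⟨Fin.snoc f.1 N, by
      refine ⟨fun i j hij => ?_, fun i => ?_⟩
      · induction j using Fin.lastCases with
        | last =>
          induction i using Fin.lastCases with
          | last => simp
          | cast i => simpa using Nat.lt_succ_iff.1 (f.2.2 i)
        | cast j =>
          induction i using Fin.lastCases with
          | last => exact absurd hij (not_le.2 (Fin.castSucc_lt_last j))
          | cast i => simpa using f.2.1 (Fin.castSucc_le_castSucc_iff.1 hij)
      · induction i using Fin.lastCases with
        | last => simp
        | cast i => simpa using f.2.2 i⟩

theorem BoundedSeq.glue_bijective (N n : ℕ) : Function.Bijective (BoundedSeq.glue N n) := by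
  constructor
  · rintro (f | f) (g | g) h
    · exact congrArg Sum.inl (Subtype.ext (congrArg (fun x => x.1) h))
    · have h1 := congrFun (congrArg Subtype.val h) (Fin.last n)
      have h2 := f.2.2 (Fin.last n)
      simp [BoundedSeq.glue] at h1
      omega
    · have h1 := congrFun (congrArg Subtype.val h) (Fin.last n)
      have h2 := g.2.2 (Fin.last n)
      simp [BoundedSeq.glue] at h1
      omega
    · refine congrArg Sum.inr (Subtype.ext (funext fun i => ?_))
      simpa [BoundedSeq.glue] using congrFun (congrArg Subtype.val h) i.castSucc
  · intro f
    by_cases h : f.1 (Fin.last n) < N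
    · exact ⟨.inl ⟨f.1, f.2.1, fun i => (f.2.1 (Fin.le_last i)).trans_lt h⟩, rfl⟩
    · have hlast : f.1 (Fin.last n) = N := by
        have := f.2.2 (Fin.last n)
        omega
      refine ⟨.inr ⟨fun i => f.1 i.castSucc,
        fun i j hij => f.2.1 (Fin.castSucc_le_castSucc_iff.2 hij), fun i => f.2.2 _⟩, ?_⟩
      refine Subtype.ext (funext fun i => ?_)
      induction i using Fin.lastCases with
      | last => simp [BoundedSeq.glue, hlast]
      | cast i => simp [BoundedSeq.glue]

/-- The bijection `BoundedSeq.glue` is the combinatorial form of the recursion for `pathSum`. -/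
theorem sum_boundedSeq (v : ℕ → ℕ → R) (N a n : ℕ) :
    ∑ f : BoundedSeq N n, ∏ i, v (f.1 i) (a + i) = pathSum v N a (a + n) := by
  have hzero : ∀ N, ∑ f : BoundedSeq N 0, ∏ i, v (f.1 i) (a + i) = 1 := by
    intro N
    have : Unique (BoundedSeq N 0) :=
      { default := ⟨Fin.elim0, fun i => i.elim0, fun i => i.elim0⟩
        uniq := fun _ => Subtype.ext (Subsingleton.elim _ _) }
    rw [Fintype.sum_unique]
    simp
  induction N generalizing n with
  | zero =>
    cases n with
    | zero => rw [hzero, add_zero, pathSum_self]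
    | succ n =>
      have : IsEmpty (BoundedSeq 0 (n + 1)) := ⟨fun f => Nat.not_lt_zero _ (f.2.2 0)⟩
      rw [Fintype.sum_empty]
      simp [pathSum]
  | succ N ihN =>
    induction n with
    | zero => rw [hzero, add_zero, pathSum_self]
    | succ n ihn =>
      rw [← Fintype.sum_bijective _ (BoundedSeq.glue_bijective N n) _ _ (fun _ => rfl),
        Fintype.sum_sum_type, ← add_assoc, pathSum, ← ihn, Finset.mul_sum]
      congr 1
      · exact ihN (n + 1)
      · refine Finset.sum_congr rfl fun f _ => ?_
        rw [Fin.prod_univ_castSucc, mul_comm]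
        simp [BoundedSeq.glue]

theorem truncation_essential {n : ℕ} (g : Fin n → ℕ+) (v : ℕ → ℕ → Series) (a : ℕ)
    (hv : ∀ m (i : Fin n), v m (a + i) = MvPowerSeries.X m ^ (g i : ℕ)) (N : ℕ) :
    truncation N (essential g) = pathSum v N a (a + n) := by
  rw [essential, truncation_monomialSum (κ := BoundedSeq N n) _ N (fun f => ⟨f.1, f.2.1⟩),
    ← sum_boundedSeq]
  · refine Finset.sum_congr rfl fun f _ => ?_
    rw [monotoneWeight, monomial_sum_single]
    exact Finset.prod_congr rfl fun i _ => (hv _ i).symm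
  · intro f f' h
    exact Subtype.ext (congrArg (fun x => x.1) h)
  · intro f
    rw [monotoneWeight, forall_mem_support_sum_lt_iff]
    constructor
    · rintro ⟨f, rfl⟩ x
      exact f.2.2 x
    · intro h
      exact ⟨⟨f.1, f.2, h⟩, rfl⟩

/-! ### Complementary column sets from a diagram in a rectangle -/

theorem rowLen_le_of_le_rect {r s : ℕ} {μ : YoungDiagram} (h : μ ≤ rect r s) (i : ℕ) :
    μ.rowLen i ≤ s := by
  by_contra! hlt
  exact lt_irrefl s (mem_rect.1 (h (YoungDiagram.mem_iff_lt_rowLen.2 hlt))).2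

theorem colLen_le_of_le_rect {r s : ℕ} {μ : YoungDiagram} (h : μ ≤ rect r s) (j : ℕ) :
    μ.colLen j ≤ r := by
  by_contra! hlt
  exact lt_irrefl r (mem_rect.1 (h (YoungDiagram.mem_iff_lt_colLen.2 hlt))).1

theorem lt_of_mem_of_le_rect {r s : ℕ} {μ : YoungDiagram} (h : μ ≤ rect r s) :
    ∀ x ∈ μ, x.1 < r := fun _ hx => (mem_rect.1 (h hx)).1

theorem beta_lt {r s : ℕ} {μ : YoungDiagram} (h : μ ≤ rect r s) (i : Fin r) :
    beta r μ i < r + s := by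
  have := rowLen_le_of_le_rect h (r - 1 - i)
  simp only [beta]
  omega

/-- The reversal of columns in `dualShape` cancels the reversal of rows in `beta`. -/
theorem beta_dualShape (r s : ℕ) (μ : YoungDiagram) (j : Fin s) :
    beta s (dualShape r s μ) j = r - μ.colLen j + j := by
  have h : (dualShape r s μ).rowLen (s - 1 - j) = r - μ.colLen j := by
    have hj : s - 1 - (s - 1 - (j : ℕ)) = j := by omega
    apply eq_of_forall_lt_iff
    intro k
    rw [← YoungDiagram.mem_iff_lt_rowLen, mem_dualShape, hj]
    exact ⟨fun h => h.2, fun h => ⟨by omega, h⟩⟩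
  rw [beta, h]

theorem beta_dualShape_lt {r s : ℕ} (μ : YoungDiagram) (j : Fin s) :
    beta s (dualShape r s μ) j < r + s := by
  rw [beta_dualShape]
  omega

/-- If the box is in `μ`, then `r - μ'_j ≤ i` and `j` is less than the row length. If it is not,
both inequalities reverse, with strictness in the first; so the two sets of beta numbers are
disjoint and their relative order encodes `μ`. -/
theorem beta_dualShape_lt_beta {r s : ℕ} {μ : YoungDiagram} (h : μ ≤ rect r s) {i : Fin r}
    {j : Fin s} (hx : (r - 1 - (i : ℕ), (j : ℕ)) ∈ μ) :
    beta s (dualShape r s μ) j < beta r μ i := by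
  rw [beta_dualShape, beta]
  have h1 := YoungDiagram.mem_iff_lt_rowLen.1 hx
  have h2 := YoungDiagram.mem_iff_lt_colLen.1 hx
  have h3 := colLen_le_of_le_rect h j
  omega

theorem beta_lt_beta_dualShape {r s : ℕ} {μ : YoungDiagram} (h : μ ≤ rect r s) {i : Fin r}
    {j : Fin s} (hx : (r - 1 - (i : ℕ), (j : ℕ)) ∉ μ) :
    beta r μ i < beta s (dualShape r s μ) j := by
  rw [beta_dualShape, beta]
  have h1 := mt YoungDiagram.mem_iff_lt_rowLen.2 hx
  have h2 := mt YoungDiagram.mem_iff_lt_colLen.2 hx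
  have h3 := colLen_le_of_le_rect h j
  omega

/-- The diagrams inside the rectangle `(s^r)`. -/
abbrev Subrect (r s : ℕ) : Type := {μ : YoungDiagram // μ ≤ rect r s}

/-- The columns that belong to the first block. -/
def leftCols {r s : ℕ} (μ : Subrect r s) (i : Fin r) : Fin (r + s) :=
  ⟨beta r μ.1 i, beta_lt μ.2 i⟩

/-- The columns that belong to the second block. -/
def rightCols {r s : ℕ} (μ : Subrect r s) (j : Fin s) : Fin (r + s) :=
  ⟨beta s (dualShape r s μ.1) j, beta_dualShape_lt μ.1 j⟩

theorem leftCols_strictMono {r s : ℕ} (μ : Subrect r s) : StrictMono (leftCols μ) :=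
  fun _ _ h => beta_strictMono r μ.1 h

theorem rightCols_strictMono {r s : ℕ} (μ : Subrect r s) : StrictMono (rightCols μ) :=
  fun _ _ h => beta_strictMono s (dualShape r s μ.1) h

theorem rightCols_lt_leftCols_iff {r s : ℕ} (μ : Subrect r s) (i : Fin r) (j : Fin s) :
    rightCols μ j < leftCols μ i ↔ (r - 1 - (i : ℕ), (j : ℕ)) ∈ μ.1 := by
  refine ⟨fun h => ?_, fun h => beta_dualShape_lt_beta μ.2 h⟩
  by_contra hx
  exact lt_asymm h (beta_lt_beta_dualShape μ.2 hx)

theorem leftCols_lt_rightCols_iff {r s : ℕ} (μ : Subrect r s) (i : Fin r) (j : Fin s) :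
    leftCols μ i < rightCols μ j ↔ (r - 1 - (i : ℕ), (j : ℕ)) ∉ μ.1 :=
  ⟨fun h hx => lt_asymm h (beta_dualShape_lt_beta μ.2 hx),
    fun h => beta_lt_beta_dualShape μ.2 h⟩

theorem leftCols_ne_rightCols {r s : ℕ} (μ : Subrect r s) (i : Fin r) (j : Fin s) :
    leftCols μ i ≠ rightCols μ j := by
  by_cases h : (r - 1 - (i : ℕ), (j : ℕ)) ∈ μ.1
  · exact ((rightCols_lt_leftCols_iff μ i j).2 h).ne'
  · exact ((leftCols_lt_rightCols_iff μ i j).2 h).ne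

theorem append_cols_injective {r s : ℕ} (μ : Subrect r s) :
    Function.Injective (Fin.append (leftCols μ) (rightCols μ)) :=
  Fin.append_injective_iff.2 ⟨(leftCols_strictMono μ).injective,
    (rightCols_strictMono μ).injective, leftCols_ne_rightCols μ⟩

/-! ### Shuffles and the Laplace expansion -/

/-- The shuffle permutation of a diagram inside a rectangle. -/
def shuffle {r s : ℕ} (μ : Subrect r s) : Equiv.Perm (Fin (r + s)) :=
  Equiv.ofBijective _ (Finite.injective_iff_bijective.1 (append_cols_injective μ))

theorem shuffle_castAdd {r s : ℕ} (μ : Subrect r s) (i : Fin r) :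
    shuffle μ (Fin.castAdd s i) = leftCols μ i :=
  Fin.append_left _ _ i

theorem shuffle_natAdd {r s : ℕ} (μ : Subrect r s) (j : Fin s) :
    shuffle μ (Fin.natAdd r j) = rightCols μ j :=
  Fin.append_right _ _ j

theorem prod_neg_one_mem {r s : ℕ} (μ : Subrect r s) :
    ∏ i : Fin r, ∏ j : Fin s,
      (if leftCols μ i < rightCols μ j then (1 : ℤˣ) else -1) = (-1) ^ μ.1.card := by
  classical
  have h1 : ∏ i : Fin r, ∏ j : Fin s,
      (if leftCols μ i < rightCols μ j then (1 : ℤˣ) else -1) =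
      ∏ i : Fin r, ∏ j : Fin s, (if ((i : ℕ), (j : ℕ)) ∈ μ.1 then (-1 : ℤˣ) else 1) := by
    -- Beta numbers list the rows from the bottom, so reversing the index restores the usual row
    -- order.
    rw [← Equiv.prod_comp Fin.revPerm]
    refine Finset.prod_congr rfl fun i _ => Finset.prod_congr rfl fun j _ => ?_
    have : r - 1 - ((Fin.revPerm i : Fin r) : ℕ) = i := by simp; omega
    simp only [leftCols_lt_rightCols_iff, this, ite_not]
  have h2 : ∏ x ∈ Finset.range r ×ˢ Finset.range s, (if x ∈ μ.1 then (-1 : ℤˣ) else 1) =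
      ∏ i : Fin r, ∏ j : Fin s, (if ((i : ℕ), (j : ℕ)) ∈ μ.1 then (-1 : ℤˣ) else 1) := by
    rw [Finset.prod_product, Finset.prod_range]
    simp_rw [Finset.prod_range]
  rw [h1, ← h2, Finset.prod_ite, Finset.prod_const, Finset.prod_const_one, mul_one]
  congr 2
  ext ⟨i, j⟩
  rw [Finset.mem_filter, YoungDiagram.mem_cells]
  exact ⟨fun h => h.2, fun h => ⟨μ.2 h, h⟩⟩

/-- Both blocks of columns are increasing, so inversions occur only between the blocks, one for each
box of `μ`. -/
theorem sign_shuffle {r s : ℕ} (μ : Subrect r s) :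
    Equiv.Perm.sign (shuffle μ) = (-1) ^ μ.1.card := by
  rw [Equiv.Perm.sign_eq_prod_prod_Ioi, ← prod_neg_one_mem]
  have h : ∀ i, ∏ j ∈ Finset.Ioi i, (if shuffle μ i < shuffle μ j then (1 : ℤˣ) else -1) =
      ∏ j, if i < j then (if shuffle μ i < shuffle μ j then (1 : ℤˣ) else -1) else 1 := by
    intro i
    rw [← Finset.prod_filter]
    congr 1
    ext j
    simp
  simp_rw [h, Fin.prod_univ_add, shuffle_castAdd, shuffle_natAdd]
  have hLL : ∀ i i' : Fin r, (if Fin.castAdd s i < Fin.castAdd s i' then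
      (if leftCols μ i < leftCols μ i' then (1 : ℤˣ) else -1) else 1) = 1 := by
    intro i i'
    split_ifs with h1 h2
    · rfl
    · exact absurd (leftCols_strictMono μ h1) h2
    · rfl
  have hRR : ∀ i i' : Fin s, (if i < i' then
      (if rightCols μ i < rightCols μ i' then (1 : ℤˣ) else -1) else 1) = 1 := by
    intro i i'
    split_ifs with h1 h2
    · rfl
    · exact absurd (rightCols_strictMono μ h1) h2
    · rfl
  have hLR : ∀ (i : Fin r) (j : Fin s), Fin.castAdd s i < Fin.natAdd r j := by
    intro i j
    rw [Fin.lt_def, Fin.val_castAdd, Fin.val_natAdd]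
    omega
  simp [hLL, hRR, hLR, (hLR _ _).not_gt]

theorem exists_leftCols_eq {r s : ℕ} {k : Fin r → Fin (r + s)} (hk : StrictMono k) :
    ∃ μ : Subrect r s, leftCols μ = k := by
  obtain ⟨μ, hμ, hb⟩ := exists_beta_eq (k := fun i => (k i : ℕ)) fun _ _ h => hk h
  refine ⟨⟨μ, ?_⟩, funext fun i => Fin.ext (congrFun hb i)⟩
  rintro ⟨i, j⟩ hx
  have hi : i < r := hμ _ hx
  have hx' : (i, j) ∈ μ := hx
  rw [mem_iff_lt_beta hi, hb] at hx'
  refine mem_rect.2 ⟨hi, ?_⟩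
  have h1 := add_le_of_strictMono (k := fun i => (k i : ℕ)) (fun _ _ h => hk h)
    (i := ⟨r - 1 - i, by omega⟩) (j := ⟨r - 1, by omega⟩) (Fin.le_def.2 (by simp only; omega))
  have h2 := (k ⟨r - 1, by omega⟩).2
  simp only at h1 hx'
  omega

theorem leftCols_injective (r s : ℕ) :
    Function.Injective (leftCols : Subrect r s → Fin r → Fin (r + s)) := fun μ ν h =>
  Subtype.ext (beta_injective (lt_of_mem_of_le_rect μ.2) (lt_of_mem_of_le_rect ν.2)
    (funext fun i => congrArg Fin.val (congrFun h i)))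

/-- The permutation that acts separately on the two blocks. -/
def blockPerm {r s : ℕ} (τ : Equiv.Perm (Fin r) × Equiv.Perm (Fin s)) :
    Equiv.Perm (Fin (r + s)) :=
  finSumFinEquiv.permCongr (Equiv.Perm.sumCongr τ.1 τ.2)

theorem blockPerm_castAdd {r s : ℕ} (τ : Equiv.Perm (Fin r) × Equiv.Perm (Fin s)) (i : Fin r) :
    blockPerm τ (Fin.castAdd s i) = Fin.castAdd s (τ.1 i) := by
  simp [blockPerm, Equiv.permCongr_apply]

theorem blockPerm_natAdd {r s : ℕ} (τ : Equiv.Perm (Fin r) × Equiv.Perm (Fin s)) (j : Fin s) :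
    blockPerm τ (Fin.natAdd r j) = Fin.natAdd r (τ.2 j) := by
  simp [blockPerm, Equiv.permCongr_apply]

theorem sign_blockPerm {r s : ℕ} (τ : Equiv.Perm (Fin r) × Equiv.Perm (Fin s)) :
    Equiv.Perm.sign (blockPerm τ) = Equiv.Perm.sign τ.1 * Equiv.Perm.sign τ.2 := by
  rw [blockPerm, Equiv.Perm.sign_permCongr, Equiv.Perm.sign_sumCongr]

/-- The shuffles represent the left cosets of `S_r × S_s` in `S_{r+s}`: a coset is determined by the
image of the first `r` indices, and sorting that image gives the diagram. -/
theorem shuffle_mul_blockPerm_bijective (r s : ℕ) :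
    Function.Bijective
      fun p : Subrect r s × (Equiv.Perm (Fin r) × Equiv.Perm (Fin s)) =>
        shuffle p.1 * blockPerm p.2 := by
  constructor
  · rintro ⟨μ, τ⟩ ⟨ν, ρ⟩ h
    simp only at h
    have hL : ∀ i, leftCols μ (τ.1 i) = leftCols ν (ρ.1 i) := by
      intro i
      simpa [blockPerm_castAdd, shuffle_castAdd] using Equiv.congr_fun h (Fin.castAdd s i)
    have hrange : Set.range (leftCols μ) = Set.range (leftCols ν) := by
      rw [← τ.1.surjective.range_comp, ← ρ.1.surjective.range_comp (leftCols ν)]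
      exact congrArg Set.range (funext hL)
    have hμν : μ = ν := leftCols_injective r s
      (((leftCols_strictMono μ).range_inj (leftCols_strictMono ν)).1 hrange)
    subst hμν
    have hR : ∀ j, rightCols μ (τ.2 j) = rightCols μ (ρ.2 j) := by
      intro j
      simpa [blockPerm_natAdd, shuffle_natAdd] using Equiv.congr_fun h (Fin.natAdd r j)
    have h1 : τ.1 = ρ.1 := Equiv.ext fun i => (leftCols_strictMono μ).injective (hL i)
    have h2 : τ.2 = ρ.2 := Equiv.ext fun j => (rightCols_strictMono μ).injective (hR j)
    rw [Prod.ext h1 h2]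
  · intro σ
    let K : Finset (Fin (r + s)) := Finset.univ.map ((Fin.castAddEmb s).trans σ.toEmbedding)
    have hK : K.card = r := by simp [K]
    obtain ⟨μ, hμ⟩ := exists_leftCols_eq (K.orderEmbOfFin hK).strictMono
    have hmem : ∀ i, ∃ i', leftCols μ i' = σ (Fin.castAdd s i) := by
      intro i
      have h1 : σ (Fin.castAdd s i) ∈ (K : Set (Fin (r + s))) := by simp [K]
      rw [← Finset.range_orderEmbOfFin K hK, ← hμ] at h1
      exact h1
    -- After undoing the shuffle, `σ` preserves the first block, hence also the second, and so
    -- splits as a pair.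
    let π : Equiv.Perm (Fin r ⊕ Fin s) := finSumFinEquiv.symm.permCongr ((shuffle μ)⁻¹ * σ)
    have hπ : π ∈ (Equiv.Perm.sumCongrHom (Fin r) (Fin s)).range := by
      refine Equiv.Perm.mem_sumCongrHom_range_of_perm_mapsTo_inl ?_
      rintro _ ⟨i, rfl⟩
      obtain ⟨i', hi'⟩ := hmem i
      refine ⟨i', ?_⟩
      have : (shuffle μ)⁻¹ (σ (Fin.castAdd s i)) = Fin.castAdd s i' := by
        rw [Equiv.Perm.inv_eq_iff_eq, shuffle_castAdd, hi']
      simp [π, Equiv.permCongr_apply, this]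
    obtain ⟨τ, hτ⟩ := hπ
    refine ⟨⟨μ, τ⟩, ?_⟩
    have hb : blockPerm τ = (shuffle μ)⁻¹ * σ := by
      change finSumFinEquiv.permCongr (Equiv.Perm.sumCongrHom (Fin r) (Fin s) τ) = _
      rw [hτ]
      ext x
      simp [π, Equiv.permCongr_apply]
    simp only [hb, mul_inv_cancel_left]

/-- Laplace expansion along the first rows, with the sets of columns indexed by the diagrams
inside a rectangle. -/
theorem det_append {r s : ℕ} (A : Matrix (Fin r) (Fin (r + s)) R)
    (B : Matrix (Fin s) (Fin (r + s)) R) :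
    Matrix.det (Matrix.of (Fin.append A B) : Matrix (Fin (r + s)) (Fin (r + s)) R) =
      ∑ μ : Subrect r s, (-1 : R) ^ μ.1.card * (A.submatrix id (leftCols μ)).det *
        (B.submatrix id (rightCols μ)).det := by
  -- After transposing, the permutation selects columns and the rows stay in their two blocks.
  rw [← Matrix.det_transpose, Matrix.det_apply',
    ← Fintype.sum_bijective _ (shuffle_mul_blockPerm_bijective r s) _ _ (fun _ => rfl),
    Fintype.sum_prod_type]
  refine Finset.sum_congr rfl fun μ _ => ?_
  rw [← Matrix.det_transpose (A.submatrix _ _), ← Matrix.det_transpose (B.submatrix _ _),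
    Matrix.det_apply', Matrix.det_apply', mul_assoc, Finset.sum_mul_sum, Finset.mul_sum,
    Fintype.sum_prod_type]
  refine Finset.sum_congr rfl fun τ _ => ?_
  rw [Finset.mul_sum]
  refine Finset.sum_congr rfl fun ρ _ => ?_
  rw [Fin.prod_univ_add, Equiv.Perm.sign_mul, sign_shuffle, sign_blockPerm]
  simp only [Equiv.Perm.mul_apply, blockPerm_castAdd, blockPerm_natAdd, shuffle_castAdd,
    shuffle_natAdd, Matrix.transpose_apply, Matrix.of_apply, Matrix.submatrix_apply, id]
  have hA : ∀ i x, Fin.append A B (Fin.castAdd s i) x = A i x := fun i x =>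
    congrFun (Fin.append_left A B i) x
  have hB : ∀ i x, Fin.append A B (Fin.natAdd r i) x = B i x := fun i x =>
    congrFun (Fin.append_right A B i) x
  simp only [hA, hB]
  push_cast
  ring

/-! ### Jacobi–Trudi for power series and the conclusion -/

/-- The weight of a horizontal step that starts at position `p`, at height `m`. -/
def stepWeight (r : ℕ) (c : ℤ → ℕ+) (m p : ℕ) : Series :=
  MvPowerSeries.X m ^ (c ((p : ℤ) + 1 - r) : ℕ)

theorem truncation_essentialBlock (r n : ℕ) (c : ℤ → ℕ+) (N : ℕ) (i : Fin r) (j : Fin n) :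
    truncation N (essentialBlock r n c i j) = pathSum (stepWeight r c) N i j := by
  rw [essentialBlock, Matrix.of_apply]
  split_ifs with h
  · rw [map_zero, pathSum_of_lt _ _ h]
  · rw [truncation_essential _ (stepWeight r c) i, Nat.add_sub_cancel' (not_lt.1 h)]
    intro m k
    rw [stepWeight]
    congr 3
    push_cast
    ring

/-- The Jacobi–Trudi formula. -/
theorem schurQ_eq_det {r n : ℕ} {μ : YoungDiagram} (hμ : ∀ x ∈ μ, x.1 < r) (γ : Tableau μ ℕ+)
    (c : ℤ → ℕ+) (hc : ∀ x : μ.cells, c ((x.1.2 : ℤ) - (x.1.1 : ℤ)) = γ x) (k : Fin r → Fin n)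
    (hk : ∀ i, (k i : ℕ) = beta r μ i) :
    schurQ μ γ = ((essentialBlock r n c).submatrix id k).det := by
  refine ext_truncation fun N => ?_
  rw [truncation_schurQ γ (fun m x => stepWeight r c m (x.2 + (r - 1 - x.1))) _ N,
    tableauSum_eq_minor _ N hμ, RingHom.map_det, minor]
  · congr 1
    ext1 i j
    simp [truncation_essentialBlock, hk]
  · intro m x
    -- The existence of a box forces `r ≥ 1`, so the natural subtractions are exact and position `j
    -- + (r - 1 - i)` carries the exponent `c (j - i)`.
    have hx : x.1.1 < r := hμ x.1 x.2
    rw [stepWeight, ← hc]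
    congr 3
    push_cast [Nat.cast_sub (show x.1.1 ≤ r - 1 by omega), Nat.cast_sub (show 1 ≤ r by omega)]
    ring

end SchurQuasi

end

theorem mainTheorem7 (r s : ℕ)
    (γ : SchurQuasi.Tableau (SchurQuasi.rect r s) ℕ+)
    (hγ : γ ∈ SchurQuasi.diagTableaux (SchurQuasi.rect r s) ℕ+)
    (δ : SchurQuasi.Tableau (SchurQuasi.rect s r) ℕ+)
    (hδ : δ ∈ SchurQuasi.diagTableaux (SchurQuasi.rect s r) ℕ+)
    (c d : ℤ → ℕ+)
    (hc : ∀ x : (SchurQuasi.rect r s).cells, c ((x.1.2 : ℤ) - (x.1.1 : ℤ)) = γ x)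
    (hd : ∀ x : (SchurQuasi.rect s r).cells, d ((x.1.2 : ℤ) - (x.1.1 : ℤ)) = δ x) :
    ∑ μ : {μ : YoungDiagram // μ ≤ SchurQuasi.rect r s},
        (-1 : SchurQuasi.Series) ^ μ.1.card
          * SchurQuasi.schurQ μ.1 (γ.restrict μ.2)
          * SchurQuasi.schurQ (SchurQuasi.dualShape r s μ.1)
              (δ.restrict (SchurQuasi.dualShape_le r s μ.1))
      = Matrix.det (Matrix.of (Fin.append
          (SchurQuasi.essentialBlock r (r + s) c)
          (SchurQuasi.essentialBlock s (r + s) d)) :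
            Matrix (Fin (r + s)) (Fin (r + s)) SchurQuasi.Series) := by
  rw [SchurQuasi.det_append]
  refine Finset.sum_congr rfl fun μ _ => ?_
  rw [SchurQuasi.schurQ_eq_det (SchurQuasi.lt_of_mem_of_le_rect μ.2) (γ.restrict μ.2) c
      (fun x => hc ⟨x.1, μ.2 x.2⟩) (SchurQuasi.leftCols μ) (fun _ => rfl),
    SchurQuasi.schurQ_eq_det
      (SchurQuasi.lt_of_mem_of_le_rect (SchurQuasi.dualShape_le r s μ.1))
      (δ.restrict (SchurQuasi.dualShape_le r s μ.1)) d
      (fun x => hd ⟨x.1, SchurQuasi.dualShape_le r s μ.1 x.2⟩) (SchurQuasi.rightCols μ)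
      (fun _ => rfl)]
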